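/- Let $q$ be a prime power, let $1\le \ell\le \ell'$ be integers, $m=\ell+\ell'$, and let $X=(X_{ij})$ be an $\ell\times\ell'$ matrix of independent indeterminates over $\mathbb F_q$. Let $\mathcal F(\ell,m)\subseteq\mathbb F_q[X]$ be the $\mathbb F_q$-linear span of all $i\times i$ minors of $X$, $0\le i\le \ell$ (the $0\times 0$ minor being $1$). For $f\in\mathbb F_q[X]$ let $\mathrm{Ev}(f)=(f(P))_P$, where $P$ runs over all $\ell\times\ell'$ matrices over $\mathbb F_q$. Let $C^{\mathbb A}(\ell,m)=\mathrm{Ev}(\mathcal F(\ell,m))$ be the affine Grassmann code, and let $d(\ell,m)$ be its minimum distance. The leading maximal minor of an $\ell\times\ell'$ matrix $Y$ is the determinant of the submatrix formed by its first $\ell$ columns. Let $\mathfrak G(\ell,m)$ be the group of affine transformations $X\mapsto XA^{-1}+\mathbf u$ with $A\in GL_{\ell'}(\mathbb F_q)$ and $\mathbf u\in M_{\ell\times\ell'}(\mathbb F_q)$, acting on polynomials by $f(X)\mapsto f(XA^{-1}+\mathbf u)$. Let $f\in\mathcal F(\ell,m)$. Then $\mathrm{Ev}(f)$ is a minimum weight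 codeword of $C^{\mathbb A}(\ell,m)$ (that is, a nonzero codeword of least Hamming weight among the nonzero codewords) if and only if $f$ lies in the $\mathfrak G(\ell,m)$-orbit of the leading maximal minor of $X$. In other words, the Hamming weight of $\mathrm{Ev}(f)$ equals $d(\ell,m)$ if and only if $f$ is the leading maximal minor of $XA^{-1}+\mathbf u$ for some $A\in GL_{\ell'}(\mathbb F_q)$ and $\mathbf u\in M_{\ell\times\ell'}(\mathbb F_q)$. -/

import Mathlib

open MvPolynomial

namespace AffineGrassmann

noncomputable section

/-! ### Minors and the space they span -/

/-- The generic `ℓ × ℓ'` matrix `X`; its entries are the variables of `K[X]`, which is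
`MvPolynomial (Fin ℓ × Fin ℓ') K`. -/
abbrev genericMatrix (K : Type*) [Field K] (ℓ ℓ' : ℕ) :
    Matrix (Fin ℓ) (Fin ℓ') (MvPolynomial (Fin ℓ × Fin ℓ') K) :=
  Matrix.mvPolynomialX (Fin ℓ) (Fin ℓ') K

/-- The set of `i × i` minors of `X`. The choices of rows and of columns are increasing
sequences. For `i = 0` the only minor is `1`. -/
def minorsOfOrder (K : Type*) [Field K] (ℓ ℓ' i : ℕ) :
    Set (MvPolynomial (Fin ℓ × Fin ℓ') K) :=
  {M | ∃ (r : Fin i ↪o Fin ℓ) (c : Fin i ↪o Fin ℓ'),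
    M = ((genericMatrix K ℓ ℓ').submatrix r c).det}

/-- The set of all minors of `X`, of orders `0, …, ℓ`. -/
def minors (K : Type*) [Field K] (ℓ ℓ' : ℕ) : Set (MvPolynomial (Fin ℓ × Fin ℓ') K) :=
  {M | ∃ i : ℕ, i ≤ ℓ ∧ M ∈ minorsOfOrder K ℓ ℓ' i}

/-- The `K`-linear subspace of `K[X]` generated by all minors of `X`. -/
def minorSpace (K : Type*) [Field K] (ℓ ℓ' : ℕ) :
    Submodule K (MvPolynomial (Fin ℓ × Fin ℓ') K) :=
  Submodule.span K (minors K ℓ ℓ')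

/-- The leading maximal minor of an `ℓ × ℓ'` matrix, `ℓ ≤ ℓ'`: the determinant of its first
`ℓ` columns. -/
def leadingMaximalMinor {R : Type*} [CommRing R] {ℓ ℓ' : ℕ} (h : ℓ ≤ ℓ')
    (Y : Matrix (Fin ℓ) (Fin ℓ') R) : R :=
  (Y.submatrix id (Fin.castLE h)).det

/-! ### Codes -/

/-- The value `f(P)` of a polynomial at a matrix `P`. -/
def evalAt {K : Type*} [Field K] {ℓ ℓ' : ℕ} (f : MvPolynomial (Fin ℓ × Fin ℓ') K)
    (P : Matrix (Fin ℓ) (Fin ℓ') K) : K :=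
  MvPolynomial.eval (fun p => P p.1 p.2) f

/-- The evaluation map; the coordinates of a word are indexed by the matrices over `K`. -/
def Ev (K : Type*) [Field K] (ℓ ℓ' : ℕ) :
    MvPolynomial (Fin ℓ × Fin ℓ') K →ₗ[K] (Matrix (Fin ℓ) (Fin ℓ') K → K) where
  toFun f := fun P => evalAt f P
  map_add' f g := by funext P; simp [evalAt]
  map_smul' c f := by funext P; simp [evalAt, MvPolynomial.smul_eval]

/-- The affine Grassmann code: the image of the span of the minors under evaluation. -/
def code (K : Type*) [Field K] (ℓ ℓ' : ℕ) :
    Submodule K (Matrix (Fin ℓ) (Fin ℓ') K → K) :=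
  (minorSpace K ℓ ℓ').map (Ev K ℓ ℓ')

/-- The minimum distance of a linear code: the least Hamming distance between two distinct
codewords. -/
def minDist {K ι : Type*} [Field K] [DecidableEq K] [Fintype ι] (C : Submodule K (ι → K)) : ℕ :=
  sInf {d | ∃ x ∈ C, ∃ y ∈ C, x ≠ y ∧ d = hammingDist x y}

/-- A minimum weight codeword: a nonzero codeword whose Hamming weight is the least among all
nonzero codewords. -/
def IsMinWeightCodeword {K ι : Type*} [Field K] [DecidableEq K] [Fintype ι]
    (C : Submodule K (ι → K)) (c : ι → K) : Prop :=
  c ∈ C ∧ c ≠ 0 ∧ ∀ x ∈ C, x ≠ 0 → hammingNorm c ≤ hammingNorm x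

/-! ### The affine group and its action on polynomials -/

/-- A matrix over `K` regarded as a matrix of constant polynomials. -/
def constMatrix {K : Type*} [Field K] (ℓ ℓ' : ℕ) {a b : ℕ} (M : Matrix (Fin a) (Fin b) K) :
    Matrix (Fin a) (Fin b) (MvPolynomial (Fin ℓ × Fin ℓ') K) :=
  M.map (C : K →+* MvPolynomial (Fin ℓ × Fin ℓ') K)

/-- The matrix `X A⁻¹ + u` with entries in `K[X]`. -/
def transformedMatrix {K : Type*} [Field K] {ℓ ℓ' : ℕ} (u : Matrix (Fin ℓ) (Fin ℓ') K)
    (A : GL (Fin ℓ') K) : Matrix (Fin ℓ) (Fin ℓ') (MvPolynomial (Fin ℓ × Fin ℓ') K) :=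
  genericMatrix K ℓ ℓ' *
    constMatrix ℓ ℓ' ((A⁻¹ : GL (Fin ℓ') K) : Matrix (Fin ℓ') (Fin ℓ') K) +
      constMatrix ℓ ℓ' u

/-- The substitution `f ↦ f(X A⁻¹ + u)`. -/
def substHom {K : Type*} [Field K] {ℓ ℓ' : ℕ} (u : Matrix (Fin ℓ) (Fin ℓ') K)
    (A : GL (Fin ℓ') K) :
    MvPolynomial (Fin ℓ × Fin ℓ') K →ₐ[K] MvPolynomial (Fin ℓ × Fin ℓ') K :=
  MvPolynomial.aeval (fun p => transformedMatrix u A p.1 p.2)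

/-- On values, the substitution is composition with the affine map `P ↦ P A⁻¹ + u`. -/
theorem evalAt_substHom {K : Type*} [Field K] {ℓ ℓ' : ℕ} (u : Matrix (Fin ℓ) (Fin ℓ') K)
    (A : GL (Fin ℓ') K) (f : MvPolynomial (Fin ℓ × Fin ℓ') K)
    (P : Matrix (Fin ℓ) (Fin ℓ') K) :
    evalAt (substHom u A f) P =
      evalAt f (P * ((A⁻¹ : GL (Fin ℓ') K) : Matrix (Fin ℓ') (Fin ℓ') K) + u) := by
  unfold evalAt substHom
  rw [MvPolynomial.aeval_def, MvPolynomial.eval_eval₂]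
  congr 1
  · ext p
    simp
  · funext p
    simp [transformedMatrix, constMatrix, Matrix.mul_apply, Matrix.mvPolynomialX]

theorem substHom_one {K : Type*} [Field K] {ℓ ℓ' : ℕ} :
    substHom (0 : Matrix (Fin ℓ) (Fin ℓ') K) 1 = AlgHom.id K _ := by
  apply MvPolynomial.algHom_ext
  intro p
  have h : transformedMatrix (0 : Matrix (Fin ℓ) (Fin ℓ') K) 1 = genericMatrix K ℓ ℓ' := by
    unfold transformedMatrix constMatrix
    rw [inv_one, Units.val_one, Matrix.map_one _ (map_zero C) (map_one C), Matrix.mul_one,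
      Matrix.map_zero _ (map_zero C), add_zero]
  simp only [substHom, MvPolynomial.aeval_X, h, AlgHom.id_apply, Matrix.mvPolynomialX_apply]

theorem substHom_comp {K : Type*} [Field K] {ℓ ℓ' : ℕ} (u v : Matrix (Fin ℓ) (Fin ℓ') K)
    (A B : GL (Fin ℓ') K) :
    (substHom u A).comp (substHom v B) =
      substHom (u * ((B⁻¹ : GL (Fin ℓ') K) : Matrix (Fin ℓ') (Fin ℓ') K) + v) (B * A) := by
  apply MvPolynomial.algHom_ext
  intro p
  have h : transformedMatrix u A *
      constMatrix ℓ ℓ' ((B⁻¹ : GL (Fin ℓ') K) : Matrix (Fin ℓ') (Fin ℓ') K) +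
        constMatrix ℓ ℓ' v = transformedMatrix
        (u * ((B⁻¹ : GL (Fin ℓ') K) : Matrix (Fin ℓ') (Fin ℓ') K) + v) (B * A) := by
    unfold transformedMatrix constMatrix
    rw [mul_inv_rev, Units.val_mul, Matrix.map_mul, Matrix.map_add _ (map_add C),
      Matrix.map_mul, Matrix.add_mul, Matrix.mul_assoc, add_assoc]
  have h2 := congrFun (congrFun h p.1) p.2
  simp only [substHom, AlgHom.comp_apply, MvPolynomial.aeval_X]
  rw [← h2]
  simp only [transformedMatrix, constMatrix, Matrix.mul_apply, Matrix.add_apply,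
    Matrix.map_apply, Matrix.mvPolynomialX_apply, map_add, map_sum, map_mul,
    MvPolynomial.aeval_X, MvPolynomial.aeval_C, MvPolynomial.algebraMap_eq]

/-- The substitution `f ↦ f(X A⁻¹ + u)` as an automorphism of `K[X]`; its inverse is the
substitution `f ↦ f(X A - u A)`. -/
def subst {K : Type*} [Field K] {ℓ ℓ' : ℕ} (u : Matrix (Fin ℓ) (Fin ℓ') K)
    (A : GL (Fin ℓ') K) :
    MvPolynomial (Fin ℓ × Fin ℓ') K ≃ₐ[K] MvPolynomial (Fin ℓ × Fin ℓ') K :=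
  AlgEquiv.ofAlgHom (substHom u A)
    (substHom (-(u * (A : Matrix (Fin ℓ') (Fin ℓ') K))) A⁻¹)
    (by rw [substHom_comp]; simp [substHom_one])
    (by
      rw [substHom_comp, Matrix.neg_mul, Matrix.mul_assoc, ← Units.val_mul]
      simp [substHom_one])

/-- The group of all affine transformations `X ↦ X A⁻¹ + u`, acting on polynomials by
`f ↦ f(X A⁻¹ + u)`. -/
def affineGroup (K : Type*) [Field K] (ℓ ℓ' : ℕ) :
    Subgroup (MvPolynomial (Fin ℓ × Fin ℓ') K ≃ₐ[K] MvPolynomial (Fin ℓ × Fin ℓ') K) where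
  carrier := {φ | ∃ (u : Matrix (Fin ℓ) (Fin ℓ') K) (A : GL (Fin ℓ') K), φ = subst u A}
  mul_mem' := by
    rintro _ _ ⟨u, A, rfl⟩ ⟨v, B, rfl⟩
    refine ⟨u * ((B⁻¹ : GL (Fin ℓ') K) : Matrix (Fin ℓ') (Fin ℓ') K) + v, B * A, ?_⟩
    ext1 f
    exact DFunLike.congr_fun (substHom_comp u v A B) f
  one_mem' := by
    refine ⟨0, 1, ?_⟩
    ext1 f
    exact (DFunLike.congr_fun substHom_one f).symm
  inv_mem' := by
    rintro _ ⟨u, A, rfl⟩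
    refine ⟨-(u * (A : Matrix (Fin ℓ') (Fin ℓ') K)), A⁻¹, ?_⟩
    ext1 f
    rfl

end

end AffineGrassmann

/-!
Fix an alternating form `φ` of degree `n` on a space `V`, a linear map `ι : W → V` from a finite
space, and a tuple `v` in `V`, and consider the function `x ↦ φ (v + ι x)` on `Wⁿ`. The words of the
affine Grassmann code are of this kind: a minor of `X` is a maximal minor of `(I | X)`, so a word is
an alternating form in the rows of `(I | X)` (`exists_alternatingMap`), with `W = K^ℓ'` and `n = ℓ`.

Let `q = |K|`. A nonzero function of this kind has at least `(1 - q⁻¹) ⋯ (1 - q⁻ⁿ) |W|ⁿ` nonzero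
values (`le_hammingNorm`), by induction on `n`. Fixing one argument gives a function of the same
kind with one argument less. If some argument `x i` can be fixed at every value without the function
becoming zero, then all slices satisfy the bound for `n - 1`, which is more than enough. Otherwise
for each `i` there is a value `y i` at which fixing `x i` gives zero; after translation by `y` the
function vanishes whenever an argument does, and, being affine in each argument, it is multilinear.
So it is an alternating form on `W` (`map_add_eq_of_vanishing`). The radical of a nonzero
alternating form of degree `n` has codimension at least `n` (`card_ker_curryLeft_mul_le`), and
fixing the first argument outside the radical leaves a nonzero form of degree `n - 1`.

Equality excludes the first alternative and forces the radical to have codimension exactly `n`.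
Then the form is the pullback of the determinant along a surjection `W → Kⁿ`
(`exists_eq_det_of_card_ker`), and the function is a translate of this
(`exists_eq_det_of_hammingNorm_le`). A surjection `K^ℓ' → K^ℓ` consists of the first `ℓ` columns of
an invertible matrix, so the word is that of a leading maximal minor of `X A⁻¹ + u`. As both
polynomials have degree at most one in each variable, they agree with each other
(`eq_of_evalAt_eq`). Conversely, all leading maximal minors of `X A⁻¹ + u` have the weight of the
determinant, computed from the order of the general linear group (`hammingNorm_Ev_transformed`).
-/

open MvPolynomial

namespace AffineGrassmann

section

variable {K V W : Type*} [Field K] [AddCommGroup V] [Module K V] [AddCommGroup W] [Module K W]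

/-! ### Hamming weights of functions on tuples -/

/-- Weights are invariant under reindexing, whatever the `Fintype` instances are. -/
theorem hammingNorm_comp_equiv {ι κ : Type*} [Fintype ι] [Fintype κ] [DecidableEq K]
    (e : ι ≃ κ) (g : κ → K) : hammingNorm (fun i => g (e i)) = hammingNorm g := by
  unfold hammingNorm
  refine Finset.card_bij (fun i _ => e i) (by simp) (fun a _ b _ h => e.injective h) ?_
  intro b hb
  exact ⟨e.symm b, by simpa using hb, by simp⟩

theorem hammingNorm_insertNth {W : Type*} [Fintype W] [DecidableEq K] {n : ℕ} (i : Fin (n + 1))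
    (g : (Fin (n + 1) → W) → K) :
    hammingNorm g = ∑ y : W, hammingNorm (fun x : Fin n → W => g (i.insertNth y x)) := by
  rw [← hammingNorm_comp_equiv (Fin.insertNthEquiv (fun _ => W) i) g]
  unfold hammingNorm
  simp only [Finset.card_filter]
  rw [Fintype.sum_prod_type]
  rfl

/-- `(1 - q⁻¹)(1 - q⁻²) ⋯ (1 - q⁻ⁿ)`, the proportion of invertible matrices among the `n × n`
matrices over a field with `q` elements. -/
noncomputable def invertibleDensity (q n : ℕ) : ℚ :=
  ∏ j ∈ Finset.range n, (1 - ((q : ℚ) ^ (j + 1))⁻¹)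

theorem inv_pow_lt_one {q : ℕ} (hq : 1 < q) (n : ℕ) : ((q : ℚ) ^ (n + 1))⁻¹ < 1 :=
  inv_lt_one_of_one_lt₀ (one_lt_pow₀ (by exact_mod_cast hq) (Nat.succ_ne_zero n))

theorem invertibleDensity_pos {q : ℕ} (hq : 1 < q) (n : ℕ) : 0 < invertibleDensity q n :=
  Finset.prod_pos fun j _ => sub_pos.2 (inv_pow_lt_one hq j)

theorem invertibleDensity_succ (q n : ℕ) :
    invertibleDensity q (n + 1) = invertibleDensity q n * (1 - ((q : ℚ) ^ (n + 1))⁻¹) :=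
  Finset.prod_range_succ _ _

theorem invertibleDensity_succ_lt {q : ℕ} (hq : 1 < q) (n : ℕ) :
    invertibleDensity q (n + 1) < invertibleDensity q n := by
  rw [invertibleDensity_succ]
  have h : (0 : ℚ) < ((q : ℚ) ^ (n + 1))⁻¹ := by positivity
  nlinarith [invertibleDensity_pos hq n]

/-! ### Alternating forms and their radicals -/

/-- An alternating form vanishes as soon as one argument lies in its radical, the kernel of
`AlternatingMap.curryLeft`. -/
theorem map_eq_zero_of_mem_ker_curryLeft {n : ℕ} (ψ : W [⋀^Fin (n + 1)]→ₗ[K] K)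
    {x : Fin (n + 1) → W} {i : Fin (n + 1)} (h : x i ∈ LinearMap.ker ψ.curryLeft) : ψ x = 0 := by
  rw [← Fin.insertNth_self_removeNth i x, AlternatingMap.map_insertNth,
    ← AlternatingMap.curryLeft_apply_apply, LinearMap.mem_ker.1 h]
  simp

/-- Cramer's rule: the coefficient of `w i` in a combination of `w` and a vector of the radical. -/
theorem map_update_add_sum {n : ℕ} (ψ : W [⋀^Fin (n + 1)]→ₗ[K] K) (w : Fin (n + 1) → W)
    {r : W} (hr : r ∈ LinearMap.ker ψ.curryLeft) (a : Fin (n + 1) → K) (i : Fin (n + 1)) :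
    ψ (Function.update w i (r + ∑ k, a k • w k)) = a i * ψ w := by
  have h0 : ψ (Function.update w i r) = 0 :=
    map_eq_zero_of_mem_ker_curryLeft ψ (i := i) (by simpa using hr)
  rw [AlternatingMap.map_update_add, h0, zero_add, AlternatingMap.map_update_sum,
    Finset.sum_eq_single i]
  · rw [AlternatingMap.map_update_smul, Function.update_eq_self, smul_eq_mul]
  · intro k _ hk
    rw [AlternatingMap.map_update_smul, AlternatingMap.map_update_self _ _ hk.symm, smul_zero]
  · simp

theorem add_sum_injective {n : ℕ} (ψ : W [⋀^Fin (n + 1)]→ₗ[K] K) {w : Fin (n + 1) → W}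
    (hw : ψ w ≠ 0) : Function.Injective
      (fun p : LinearMap.ker ψ.curryLeft × (Fin (n + 1) → K) => (p.1 : W) + ∑ k, p.2 k • w k) := by
  rintro ⟨r, a⟩ ⟨s, b⟩ h
  have hab : a = b := by
    funext i
    have h1 := map_update_add_sum ψ w r.2 a i
    rw [show (r : W) + ∑ k, a k • w k = s + ∑ k, b k • w k from h,
      map_update_add_sum ψ w s.2 b i] at h1
    exact (mul_right_cancel₀ hw h1).symm
  subst hab
  simpa using h

/-- The radical of a nonzero alternating form of degree `n + 1` has codimension at least
`n + 1`. -/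
theorem card_ker_curryLeft_mul_le [Fintype K] [Fintype W] {n : ℕ}
    {ψ : W [⋀^Fin (n + 1)]→ₗ[K] K} (hψ : ψ ≠ 0) :
    Nat.card (LinearMap.ker ψ.curryLeft) * Fintype.card K ^ (n + 1) ≤ Fintype.card W := by
  obtain ⟨w, hw⟩ := DFunLike.ne_iff.1 hψ
  have := Nat.card_le_card_of_injective _ (add_sum_injective ψ hw)
  simpa [Nat.card_prod] using this

/-- An alternating form of degree `n + 1` whose radical has codimension `n + 1` is the pullback
of the determinant along a surjection `p` onto `Kⁿ⁺¹`. The vectors `w` witness surjectivity. -/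
theorem exists_eq_det_of_card_ker [Fintype K] [Fintype W] {n : ℕ}
    {ψ : W [⋀^Fin (n + 1)]→ₗ[K] K} (hψ : ψ ≠ 0)
    (hcard : Fintype.card W ≤
      Nat.card (LinearMap.ker ψ.curryLeft) * Fintype.card K ^ (n + 1)) :
    ∃ (p : W →ₗ[K] (Fin (n + 1) → K)) (w : Fin (n + 1) → W),
      (∀ k, p (w k) = Pi.single k 1) ∧ ∀ x, ψ x = Matrix.det (fun i => p (x i)) := by
  classical
  -- The first vector is rescaled so that the form takes the value `1`.
  obtain ⟨w, hw⟩ : ∃ w, ψ w = 1 := by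
    obtain ⟨w, hw⟩ := DFunLike.ne_iff.1 hψ
    refine ⟨Function.update w 0 ((ψ w)⁻¹ • w 0), ?_⟩
    rw [AlternatingMap.map_update_smul, Function.update_eq_self, smul_eq_mul]
    exact inv_mul_cancel₀ hw
  have hsurj : Function.Surjective
      (fun p : LinearMap.ker ψ.curryLeft × (Fin (n + 1) → K) =>
        (p.1 : W) + ∑ k, p.2 k • w k) := by
    have hinj := add_sum_injective ψ (w := w) (by rw [hw]; exact one_ne_zero)
    refine (hinj.bijective_of_nat_card_le ?_).2
    simpa [Nat.card_prod] using hcard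
  let p : W →ₗ[K] (Fin (n + 1) → K) :=
    LinearMap.pi fun i => ψ.toMultilinearMap.toLinearMap w i
  have hp : ∀ (r : LinearMap.ker ψ.curryLeft) (a : Fin (n + 1) → K),
      p (r + ∑ k, a k • w k) = a := by
    intro r a
    funext i
    have := map_update_add_sum ψ w r.2 a i
    rw [hw, mul_one] at this
    exact this
  have hpw : ∀ k, p (w k) = Pi.single k 1 := by
    intro k
    have := hp 0 (Pi.single k 1)
    simpa [Pi.single_apply] using this
  refine ⟨p, w, hpw, fun x => ?_⟩
  let s : (Fin (n + 1) → K) →ₗ[K] W := Fintype.linearCombination K w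
  have hker : ∀ y, y - s (p y) ∈ LinearMap.ker ψ.curryLeft := by
    intro y
    obtain ⟨⟨r, a⟩, rfl⟩ := hsurj y
    simp only [hp, s, Fintype.linearCombination_apply, add_sub_cancel_right]
    exact r.2
  -- Arguments may be replaced, one at a time, by their components along `w`.
  have hrep : ∀ S : Finset (Fin (n + 1)),
      ψ x = ψ (fun i => if i ∈ S then s (p (x i)) else x i) := by
    intro S
    induction S using Finset.induction_on with
    | empty => simp
    | insert i S hi ih =>
      rw [ih]
      have e1 : (fun j => if j ∈ S then s (p (x j)) else x j) =
          Function.update (fun j => if j ∈ insert i S then s (p (x j)) else x j) i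
            ((x i - s (p (x i))) + s (p (x i))) := by
        funext j
        by_cases hj : j = i
        · subst hj; simp [hi]
        · simp [hj]
      have e2 : (fun j => if j ∈ insert i S then s (p (x j)) else x j) =
          Function.update (fun j => if j ∈ insert i S then s (p (x j)) else x j) i
            (s (p (x i))) := by
        funext j
        by_cases hj : j = i
        · subst hj; simp
        · simp [hj]
      rw [e1, AlternatingMap.map_update_add, ← e2,
        map_eq_zero_of_mem_ker_curryLeft ψ (i := i) (by simpa using hker (x i)), zero_add]
  have hdet := AlternatingMap.eq_smul_basis_det (Pi.basisFun K (Fin (n + 1)))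
    (ψ.compLinearMap s)
  have hs1 : ψ.compLinearMap s (Pi.basisFun K (Fin (n + 1))) = 1 := by
    rw [AlternatingMap.compLinearMap_apply, ← hw]
    congr 1
    funext k
    simp [s, Fintype.linearCombination_apply, Pi.single_apply]
  rw [hs1, one_smul, Pi.basisFun_det] at hdet
  rw [hrep Finset.univ]
  have := DFunLike.congr_fun hdet (fun i => p (x i))
  simp only [Finset.mem_univ, if_true]
  exact this

/-! ### The weight of an alternating form on a product of affine spaces -/

/-- If `x ↦ φ (v + ι x)` vanishes whenever one of the `x i` does, then it is multilinear, and so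
equals its part of top degree. -/
theorem map_add_eq_of_vanishing {n : ℕ} (φ : V [⋀^Fin n]→ₗ[K] K) (ι : W →ₗ[K] V)
    (v : Fin n → V)
    (h : ∀ (x : Fin n → W) (i : Fin n), x i = 0 → φ (fun j => v j + ι (x j)) = 0)
    (x : Fin n → W) : φ (fun j => v j + ι (x j)) = φ (fun j => ι (x j)) := by
  classical
  have key : ∀ (S : Finset (Fin n)) (x : Fin n → W),
      φ (fun j => v j + ι (x j)) = φ (fun j => if j ∈ S then ι (x j) else v j + ι (x j)) := by
    intro S
    induction S using Finset.induction_on with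
    | empty => simp
    | insert i S hi ih =>
      intro x
      have e1 : (fun j => if j ∈ S then ι (x j) else v j + ι (x j)) =
          Function.update (fun j => if j ∈ insert i S then ι (x j) else v j + ι (x j)) i
            (v i + ι (x i)) := by
        funext j
        by_cases hj : j = i
        · subst hj; simp [hi]
        · simp [hj]
      have e2 : Function.update
          (fun j => if j ∈ insert i S then ι (x j) else v j + ι (x j)) i (ι (x i)) =
          (fun j => if j ∈ insert i S then ι (x j) else v j + ι (x j)) := by
        funext j
        by_cases hj : j = i
        · subst hj; simp
        · simp [hj]
      -- The error term is the value, after replacement, at the tuple with `i`-th entry `0`.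
      have e3 : Function.update
          (fun j => if j ∈ insert i S then ι (x j) else v j + ι (x j)) i (v i) =
          (fun j => if j ∈ S then ι (Function.update x i 0 j)
            else v j + ι (Function.update x i 0 j)) := by
        funext j
        by_cases hj : j = i
        · subst hj; simp [hi]
        · simp [hj]
      rw [ih x, e1, AlternatingMap.map_update_add, e2, e3, ← ih,
        h (Function.update x i 0) i (by simp), zero_add]
  simpa using key Finset.univ x

/-- Fixing one argument turns an alternating form into an alternating form of one degree less. -/
theorem exists_insertNth_eq {n : ℕ} (φ : V [⋀^Fin (n + 1)]→ₗ[K] K) (ι : W →ₗ[K] V)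
    (v : Fin (n + 1) → V) (i : Fin (n + 1)) (y : W) :
    ∃ φ' : V [⋀^Fin n]→ₗ[K] K, ∀ x : Fin n → W,
      φ (fun j => v j + ι ((i.insertNth y x : Fin (n + 1) → W) j)) =
        φ' (fun j => v (i.succAbove j) + ι (x j)) := by
  refine ⟨(-1 : K) ^ (i : ℕ) • φ.curryLeft (v i + ι y), fun x => ?_⟩
  rw [← Fin.insertNth_self_removeNth i
    (fun j => v j + ι ((i.insertNth y x : Fin (n + 1) → W) j)), AlternatingMap.map_insertNth]
  have h : (i.removeNth fun j => v j + ι ((i.insertNth y x : Fin (n + 1) → W) j)) =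
      fun j => v (i.succAbove j) + ι (x j) := by
    funext j
    simp [Fin.removeNth]
  rw [h, AlternatingMap.smul_apply, AlternatingMap.curryLeft_apply_apply]
  simp [zsmul_eq_mul]

/-- Either some argument can be fixed arbitrarily without making the function `x ↦ φ (v + ι x)`
zero, or a translate of the function is an alternating form. -/
theorem exists_fix_ne_zero_or_translate {n : ℕ} (φ : V [⋀^Fin (n + 1)]→ₗ[K] K)
    (ι : W →ₗ[K] V) (v : Fin (n + 1) → V) :
    (∃ i : Fin (n + 1), ∀ y : W, (fun x : Fin n → W =>
      φ (fun j => v j + ι ((i.insertNth y x : Fin (n + 1) → W) j))) ≠ 0) ∨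
    ∃ y : Fin (n + 1) → W, ∀ x : Fin (n + 1) → W,
      φ (fun j => v j + ι (y j + x j)) = φ (fun j => ι (x j)) := by
  by_cases h : ∃ i : Fin (n + 1), ∀ y : W, (fun x : Fin n → W =>
      φ (fun j => v j + ι ((i.insertNth y x : Fin (n + 1) → W) j))) ≠ 0
  · exact Or.inl h
  · push Not at h
    choose y hy using h
    refine Or.inr ⟨y, fun x => ?_⟩
    have := map_add_eq_of_vanishing φ ι (fun j => v j + ι (y j)) ?_ x
    · simpa [add_assoc] using this
    · intro x i hx
      have h1 := congrFun (hy i) (i.removeNth (fun j => y j + x j))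
      have h2 : (i.insertNth (y i) (i.removeNth (fun j => y j + x j)) : Fin (n + 1) → W) =
          fun j => y j + x j := by
        simp [hx]
      rw [h2] at h1
      simpa [add_assoc] using h1

/-- An alternating form on `W` is nonzero in its remaining arguments once the first one lies
outside the radical. -/
theorem mul_le_hammingNorm_alternating [Fintype W] [DecidableEq K] {n : ℕ} {c : ℚ}
    (ψ : W [⋀^Fin (n + 1)]→ₗ[K] K)
    (hc : ∀ y, ψ.curryLeft y ≠ 0 → c ≤ hammingNorm (fun x : Fin n → W => ψ.curryLeft y x)) :
    ((Fintype.card W : ℚ) - Nat.card (LinearMap.ker ψ.curryLeft)) * c ≤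
      hammingNorm (fun x : Fin (n + 1) → W => ψ x) := by
  classical
  rw [hammingNorm_insertNth 0]
  push_cast
  have h1 : ∑ y ∈ Finset.univ.filter (fun y : W => ψ.curryLeft y ≠ 0), c ≤
      ∑ y : W, (hammingNorm (fun x : Fin n → W =>
        ψ ((0 : Fin (n + 1)).insertNth y x : Fin (n + 1) → W)) : ℚ) := by
    refine (Finset.sum_le_sum fun y hy => ?_).trans
      (Finset.sum_le_sum_of_subset_of_nonneg (Finset.subset_univ _) fun _ _ _ => by positivity)
    have := hc y (Finset.mem_filter.1 hy).2
    simpa [Fin.insertNth_zero', Matrix.vecCons] using this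
  refine le_trans (le_of_eq ?_) h1
  rw [Finset.sum_const, nsmul_eq_mul]
  congr 1
  have h2 := Finset.card_filter_add_card_filter_not (s := (Finset.univ : Finset W))
    (fun y : W => ψ.curryLeft y = 0)
  have h3 : Nat.card (LinearMap.ker ψ.curryLeft) =
      (Finset.univ.filter (fun y : W => ψ.curryLeft y = 0)).card := by
    rw [Nat.card_eq_fintype_card, Fintype.card_subtype]
    simp
  rw [h3, ← Finset.card_univ, ← h2]
  push_cast
  ring

theorem hammingNorm_translate {W : Type*} [AddGroup W] [Fintype W] [DecidableEq K]
    {n : ℕ} (y : Fin n → W) (g : (Fin n → W) → K) :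
    hammingNorm (fun x : Fin n → W => g (fun j => y j + x j)) = hammingNorm g :=
  hammingNorm_comp_equiv (Equiv.addLeft y) g

/-- The bound when some argument can be fixed arbitrarily: all slices have large weight. -/
theorem card_mul_le_hammingNorm {W : Type*} [Fintype W] [DecidableEq K] {n : ℕ} {c : ℚ}
    (g : (Fin (n + 1) → W) → K) (i : Fin (n + 1))
    (hc : ∀ y, c ≤ hammingNorm (fun x : Fin n → W => g (i.insertNth y x))) :
    (Fintype.card W : ℚ) * c ≤ hammingNorm g := by
  rw [hammingNorm_insertNth i]
  push_cast
  have := Finset.sum_le_sum fun (y : W) (_ : y ∈ Finset.univ) => hc y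
  simpa using this

/-- The lower bound for the weight of an alternating form in terms of the size of its radical,
given the lower bound `c` for forms of one degree less. The function is assumed to become an
alternating form after translation by `z`. -/
theorem le_hammingNorm_of_translate [Fintype W] [DecidableEq K] {n : ℕ} {c : ℚ}
    (hIH : ∀ (φ : V [⋀^Fin n]→ₗ[K] K) (ι : W →ₗ[K] V) (v : Fin n → V),
      (fun x : Fin n → W => φ (fun j => v j + ι (x j))) ≠ 0 →
      c ≤ hammingNorm (fun x : Fin n → W => φ (fun j => v j + ι (x j))))
    (φ : V [⋀^Fin (n + 1)]→ₗ[K] K) (ι : W →ₗ[K] V) (v : Fin (n + 1) → V)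
    (z : Fin (n + 1) → W)
    (hz : ∀ x : Fin (n + 1) → W, φ (fun j => v j + ι (z j + x j)) = φ (fun j => ι (x j))) :
    ((Fintype.card W : ℚ) - Nat.card (LinearMap.ker (φ.compLinearMap ι).curryLeft)) * c ≤
      hammingNorm (fun x : Fin (n + 1) → W => φ (fun j => v j + ι (x j))) := by
  rw [← hammingNorm_translate z]
  simp only [hz]
  refine mul_le_hammingNorm_alternating (φ.compLinearMap ι) fun y hy => ?_
  have h1 : ∀ x : Fin n → W, (φ.compLinearMap ι).curryLeft y x =
      φ.curryLeft (ι y) (fun j => (0 : Fin n → V) j + ι (x j)) := by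
    intro x
    simp only [AlternatingMap.curryLeft_apply_apply, AlternatingMap.compLinearMap_apply,
      Pi.zero_apply, zero_add]
    congr 1
    funext j
    refine Fin.cases ?_ (fun k => ?_) j <;> simp
  simp only [h1]
  refine hIH _ _ _ fun h0 => hy ?_
  ext x
  rw [h1]
  exact congrFun h0 x

/-- Every nonzero function `x ↦ φ (v + ι x)` on `Wⁿ` has at least as many nonzero values as the
determinant of `n` linearly independent coordinates. -/
theorem le_hammingNorm [Fintype K] [Fintype W] [DecidableEq K] (n : ℕ) :
    ∀ (φ : V [⋀^Fin n]→ₗ[K] K) (ι : W →ₗ[K] V) (v : Fin n → V),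
      (fun x : Fin n → W => φ (fun j => v j + ι (x j))) ≠ 0 →
      invertibleDensity (Fintype.card K) n * (Fintype.card W : ℚ) ^ n ≤
        hammingNorm (fun x : Fin n → W => φ (fun j => v j + ι (x j))) := by
  have hq := Fintype.one_lt_card (α := K)
  have hW : (0 : ℚ) < Fintype.card W := by exact_mod_cast Fintype.card_pos
  induction n with
  | zero =>
    intro φ ι v h
    have : 1 ≤ hammingNorm (fun x : Fin 0 → W => φ (fun j => v j + ι (x j))) :=
      hammingNorm_pos_iff.2 h
    simpa [invertibleDensity] using this
  | succ n ih =>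
    intro φ ι v h
    have hd := invertibleDensity_pos hq n
    rcases exists_fix_ne_zero_or_translate φ ι v with ⟨i, hi⟩ | ⟨z, hz⟩
    · refine le_trans ?_ (card_mul_le_hammingNorm
        (c := invertibleDensity (Fintype.card K) n * (Fintype.card W : ℚ) ^ n) _ i fun y => ?_)
      · have := mul_le_mul_of_nonneg_right (invertibleDensity_succ_lt hq n).le
          (pow_pos hW (n + 1)).le
        rw [pow_succ] at this ⊢
        linarith
      · obtain ⟨φ', hφ'⟩ := exists_insertNth_eq φ ι v i y
        have h2 := hi y
        simp only [hφ'] at h2 ⊢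
        exact ih φ' ι _ h2
    · refine le_trans ?_ (le_hammingNorm_of_translate ih φ ι v z hz)
      have hψ : φ.compLinearMap ι ≠ 0 := by
        intro h0
        apply h
        funext x
        have := hz (fun j => x j - z j)
        simp only [add_sub_cancel] at this
        rw [this]
        exact DFunLike.congr_fun h0 _
      have hr := card_ker_curryLeft_mul_le hψ
      have hr' : (Nat.card (LinearMap.ker (φ.compLinearMap ι).curryLeft) : ℚ) *
          (Fintype.card K : ℚ) ^ (n + 1) ≤ Fintype.card W := by exact_mod_cast hr
      have hqp : (0 : ℚ) < (Fintype.card K : ℚ) ^ (n + 1) := by positivity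
      rw [← le_div_iff₀ hqp, div_eq_mul_inv] at hr'
      rw [invertibleDensity_succ, pow_succ (Fintype.card W : ℚ)]
      have := mul_le_mul_of_nonneg_right hr' (mul_pos hd (pow_pos hW n)).le
      linarith

/-- In the case of equality in `le_hammingNorm`, the function is a translate of the pullback of
the determinant along a surjection onto `Kⁿ⁺¹`. -/
theorem exists_eq_det_of_hammingNorm_le [Fintype K] [Fintype W] [DecidableEq K] {n : ℕ}
    (φ : V [⋀^Fin (n + 1)]→ₗ[K] K) (ι : W →ₗ[K] V) (v : Fin (n + 1) → V)
    (h : (fun x : Fin (n + 1) → W => φ (fun j => v j + ι (x j))) ≠ 0)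
    (hle : (hammingNorm (fun x : Fin (n + 1) → W => φ (fun j => v j + ι (x j))) : ℚ) ≤
      invertibleDensity (Fintype.card K) (n + 1) * (Fintype.card W : ℚ) ^ (n + 1)) :
    ∃ (z : Fin (n + 1) → W) (p : W →ₗ[K] (Fin (n + 1) → K)) (w : Fin (n + 1) → W),
      (∀ k, p (w k) = Pi.single k 1) ∧
      ∀ x : Fin (n + 1) → W,
        φ (fun j => v j + ι (x j)) = Matrix.det (fun i => p (x i) - p (z i)) := by
  have hq := Fintype.one_lt_card (α := K)
  have hW : (0 : ℚ) < Fintype.card W := by exact_mod_cast Fintype.card_pos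
  have hd := invertibleDensity_pos hq n
  rcases exists_fix_ne_zero_or_translate φ ι v with ⟨i, hi⟩ | ⟨z, hz⟩
  · -- Here the weight exceeds the bound, since the density strictly decreases with the size.
    exfalso
    have h1 := card_mul_le_hammingNorm
      (c := invertibleDensity (Fintype.card K) n * (Fintype.card W : ℚ) ^ n)
      (fun x : Fin (n + 1) → W => φ (fun j => v j + ι (x j))) i fun y => by
        obtain ⟨φ', hφ'⟩ := exists_insertNth_eq φ ι v i y
        have h2 := hi y
        simp only [hφ'] at h2 ⊢
        exact le_hammingNorm n φ' ι _ h2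
    have := mul_lt_mul_of_pos_right (invertibleDensity_succ_lt hq n) (pow_pos hW (n + 1))
    rw [pow_succ] at this hle
    linarith
  · have hz' : ∀ x : Fin (n + 1) → W,
        φ (fun j => v j + ι (x j)) = φ.compLinearMap ι (fun j => x j - z j) := by
      intro x
      have := hz (fun j => x j - z j)
      simp only [add_sub_cancel] at this
      exact this
    have hψ : φ.compLinearMap ι ≠ 0 := by
      intro h0
      apply h
      funext x
      rw [hz', h0]
      rfl
    have h1 := (le_hammingNorm_of_translate (le_hammingNorm n) φ ι v z hz).trans hle
    have hcard : Fintype.card W ≤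
        Nat.card (LinearMap.ker (φ.compLinearMap ι).curryLeft) * Fintype.card K ^ (n + 1) := by
      have hqp : (0 : ℚ) < (Fintype.card K : ℚ) ^ (n + 1) := by positivity
      have hc := mul_pos hd (pow_pos hW n)
      have h2 : ((Fintype.card W : ℚ) -
          Nat.card (LinearMap.ker (φ.compLinearMap ι).curryLeft)) ≤
          Fintype.card W * (1 - ((Fintype.card K : ℚ) ^ (n + 1))⁻¹) := by
        refine le_of_mul_le_mul_right ?_ hc
        rw [invertibleDensity_succ, pow_succ (Fintype.card W : ℚ)] at h1
        linarith
      have h3 : (Fintype.card W : ℚ) / (Fintype.card K : ℚ) ^ (n + 1) ≤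
          Nat.card (LinearMap.ker (φ.compLinearMap ι).curryLeft) := by
        rw [div_eq_mul_inv]
        linarith
      rw [div_le_iff₀ hqp] at h3
      exact_mod_cast h3
    obtain ⟨p, w, hpw, hdet⟩ := exists_eq_det_of_card_ker hψ hcard
    refine ⟨z, p, w, hpw, fun x => ?_⟩
    rw [hz', hdet]
    simp only [map_sub]

end

/-! ### Polynomials in the span of the minors -/

/-- A minor of `X` with rows `r` and columns `c` is a maximal minor of `(I | X)`: the columns of
`I` outside the range of `r` are adjoined to the columns `c` of `X`. -/
theorem exists_alternatingMap_of_minor {K : Type*} [Field K] {ℓ ℓ' i : ℕ} (r : Fin i ↪o Fin ℓ)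
    (c : Fin i ↪o Fin ℓ') :
    ∃ φ : ((Fin ℓ → K) × (Fin ℓ' → K)) [⋀^Fin ℓ]→ₗ[K] K, ∀ P : Matrix (Fin ℓ) (Fin ℓ') K,
      (P.submatrix r c).det = φ (fun j => (Pi.single j 1, P j)) := by
  classical
  let L : ((Fin ℓ → K) × (Fin ℓ' → K)) →ₗ[K] (Fin ℓ → K) := LinearMap.pi fun k =>
    if h : k ∈ Set.range r then
      (LinearMap.proj (c h.choose)).comp (LinearMap.snd K (Fin ℓ → K) (Fin ℓ' → K))
    else (LinearMap.proj k).comp (LinearMap.fst K (Fin ℓ → K) (Fin ℓ' → K))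
  have hL1 : ∀ z a, L z (r a) = z.2 (c a) := by
    intro z a
    have h : r a ∈ Set.range r := ⟨a, rfl⟩
    have h2 : h.choose = a := r.injective h.choose_spec
    simp only [L, LinearMap.pi_apply, dif_pos h, h2]
    rfl
  have hL2 : ∀ z k, k ∉ Set.range r → L z k = z.1 k := by
    intro z k h
    simp only [L, LinearMap.pi_apply, dif_neg h]
    rfl
  refine ⟨(Matrix.detRowAlternating (R := K) (n := Fin ℓ)).compLinearMap L, fun P => ?_⟩
  let M : Matrix (Fin ℓ) (Fin ℓ) K := Matrix.of fun j => L (Pi.single j 1, P j)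
  have hdet := Matrix.twoBlockTriangular_det' M (fun k => k ∈ Set.range r) (by
    intro j hj k hk
    change L (Pi.single j 1, P j) k = 0
    rw [hL2 _ _ hk]
    have : j ≠ k := fun h => hk (h ▸ hj)
    simp [this.symm])
  have h1 : (M.toSquareBlockProp fun k => k ∉ Set.range r) = 1 := by
    ext j k
    change L (Pi.single (j : Fin ℓ) 1, P j) k = _
    rw [hL2 _ _ k.2]
    simp [Pi.single_apply, Matrix.one_apply, Subtype.ext_iff, eq_comm]
  have h2 : (M.toSquareBlockProp fun k => k ∈ Set.range r).det = (P.submatrix r c).det := by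
    rw [← Matrix.det_submatrix_equiv_self (Equiv.ofInjective r r.injective)]
    congr 1
    ext a b
    exact hL1 (Pi.single (r a) 1, P (r a)) b
  -- `convert` identifies two `Fintype` instances on the range of `r`.
  have h3 : M.det = (P.submatrix r c).det * 1 := by
    rw [← h2, ← Matrix.det_one (n := {k // k ∉ Set.range r}), ← h1]
    convert hdet
  rw [mul_one] at h3
  exact h3.symm

theorem evalAt_det_submatrix {K : Type*} [Field K] {ℓ ℓ' i : ℕ} (r : Fin i → Fin ℓ)
    (c : Fin i → Fin ℓ') (P : Matrix (Fin ℓ) (Fin ℓ') K) :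
    evalAt ((genericMatrix K ℓ ℓ').submatrix r c).det P = (P.submatrix r c).det := by
  unfold evalAt
  rw [RingHom.map_det]
  congr 1
  ext a b
  simp [Matrix.mvPolynomialX]

/-- A polynomial in the span of the minors evaluates at `P` to an alternating form in the rows of
`(I | P)`. -/
theorem exists_alternatingMap {K : Type*} [Field K] {ℓ ℓ' : ℕ}
    {f : MvPolynomial (Fin ℓ × Fin ℓ') K} (hf : f ∈ minorSpace K ℓ ℓ') :
    ∃ φ : ((Fin ℓ → K) × (Fin ℓ' → K)) [⋀^Fin ℓ]→ₗ[K] K, ∀ P : Matrix (Fin ℓ) (Fin ℓ') K,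
      evalAt f P = φ (fun j => (Pi.single j 1, P j)) := by
  induction hf using Submodule.span_induction with
  | mem g hg =>
    obtain ⟨i, -, r, c, rfl⟩ := hg
    obtain ⟨φ, hφ⟩ := exists_alternatingMap_of_minor (K := K) r c
    exact ⟨φ, fun P => (evalAt_det_submatrix r c P).trans (hφ P)⟩
  | zero => exact ⟨0, fun P => by simp [evalAt]⟩
  | add g h _ _ hg hh =>
    obtain ⟨φ, hφ⟩ := hg
    obtain ⟨χ, hχ⟩ := hh
    refine ⟨φ + χ, fun P => ?_⟩
    rw [AlternatingMap.add_apply, ← hφ, ← hχ]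
    simp [evalAt]
  | smul a g _ hg =>
    obtain ⟨φ, hφ⟩ := hg
    refine ⟨a • φ, fun P => ?_⟩
    rw [AlternatingMap.smul_apply, ← hφ]
    simp [evalAt, MvPolynomial.smul_eval]

/-- If row `i` of `Y` is affine in the variables of row `i` of `X` and involves no others, then
the minors of `Y` have degree at most one in each variable. -/
theorem degreeOf_det_submatrix_le {K : Type*} [Field K] {ℓ ℓ' i m : ℕ}
    (Y : Matrix (Fin ℓ) (Fin m) (MvPolynomial (Fin ℓ × Fin ℓ') K))
    (hY : ∀ p a b, degreeOf p (Y a b) ≤ if a = p.1 then 1 else 0)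
    {r : Fin i → Fin ℓ} (hr : Function.Injective r) (c : Fin i → Fin m) (p : Fin ℓ × Fin ℓ') :
    degreeOf p (Y.submatrix r c).det ≤ 1 := by
  classical
  rw [Matrix.det_apply]
  refine (degreeOf_sum_le _ _ _).trans (Finset.sup_le fun σ _ => ?_)
  have h : degreeOf p (∏ k, Y.submatrix r c (σ k) k) ≤ 1 := by
    refine (degreeOf_prod_le _ _ _).trans ?_
    refine (Finset.sum_le_sum fun k _ => hY p (r (σ k)) (c k)).trans ?_
    rw [← Finset.card_filter]
    refine Finset.card_le_one.2 fun a ha b hb => ?_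
    exact σ.injective (hr (((Finset.mem_filter.1 ha).2).trans (Finset.mem_filter.1 hb).2.symm))
  rcases Int.units_eq_one_or (Equiv.Perm.sign σ) with hs | hs
  · rwa [hs, one_smul]
  · rw [hs, Units.neg_smul, one_smul, degreeOf_neg]
    exact h

theorem degreeOf_genericMatrix_le {K : Type*} [Field K] {ℓ ℓ' : ℕ} (p : Fin ℓ × Fin ℓ')
    (a : Fin ℓ) (b : Fin ℓ') :
    degreeOf p (genericMatrix K ℓ ℓ' a b) ≤ if a = p.1 then 1 else 0 := by
  classical
  change degreeOf p (X (a, b)) ≤ _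
  rw [degreeOf_X]
  by_cases h : p = (a, b)
  · subst h; simp
  · simp [h]

theorem degreeOf_transformedMatrix_le {K : Type*} [Field K] {ℓ ℓ' : ℕ}
    (u : Matrix (Fin ℓ) (Fin ℓ') K) (A : GL (Fin ℓ') K) (p : Fin ℓ × Fin ℓ')
    (a : Fin ℓ) (b : Fin ℓ') :
    degreeOf p (transformedMatrix u A a b) ≤ if a = p.1 then 1 else 0 := by
  classical
  simp only [transformedMatrix, constMatrix, Matrix.add_apply, Matrix.mul_apply,
    Matrix.map_apply]
  refine (degreeOf_add_le _ _ _).trans (max_le ?_ (by rw [degreeOf_C]; exact Nat.zero_le _))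
  refine (degreeOf_sum_le _ _ _).trans (Finset.sup_le fun k _ => ?_)
  exact (degreeOf_mul_C_le _ _ _).trans (degreeOf_genericMatrix_le p a k)

theorem degreeOf_le_one_of_mem_minorSpace {K : Type*} [Field K] {ℓ ℓ' : ℕ}
    {f : MvPolynomial (Fin ℓ × Fin ℓ') K} (hf : f ∈ minorSpace K ℓ ℓ') (p : Fin ℓ × Fin ℓ') :
    degreeOf p f ≤ 1 := by
  induction hf using Submodule.span_induction with
  | mem g hg =>
    obtain ⟨i, -, r, c, rfl⟩ := hg
    exact degreeOf_det_submatrix_le _ degreeOf_genericMatrix_le r.injective c p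
  | zero => simp
  | add g h _ _ hg hh => exact (degreeOf_add_le _ _ _).trans (max_le hg hh)
  | smul a g _ hg =>
    rw [MvPolynomial.smul_eq_C_mul]
    exact (degreeOf_C_mul_le _ _ _).trans hg

/-- Polynomials of degree at most one in each variable are determined by their values, since
`1 ≤ q - 1`. -/
theorem eq_of_evalAt_eq {K : Type*} [Field K] [Fintype K] {ℓ ℓ' : ℕ}
    {f g : MvPolynomial (Fin ℓ × Fin ℓ') K} (hf : ∀ p, degreeOf p f ≤ 1)
    (hg : ∀ p, degreeOf p g ≤ 1) (h : ∀ P : Matrix (Fin ℓ) (Fin ℓ') K, evalAt f P = evalAt g P) :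
    f = g := by
  rw [← sub_eq_zero]
  refine eq_zero_of_eval_zero_at_prod_finset (f - g) (fun _ => Finset.univ) (fun p => ?_)
    fun v _ => ?_
  · rw [Finset.card_univ, sub_eq_add_neg]
    refine ((degreeOf_add_le _ _ _).trans (max_le (hf p) ?_)).trans_lt Fintype.one_lt_card
    rw [degreeOf_neg]
    exact hg p
  · have := h (fun i j => v (i, j))
    simp only [evalAt, Prod.mk.eta] at this
    rw [map_sub, this, sub_self]

/-! ### The orbit of the leading maximal minor -/

theorem subst_leadingMaximalMinor {K : Type*} [Field K] {ℓ ℓ' : ℕ} (h : ℓ ≤ ℓ')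
    (u : Matrix (Fin ℓ) (Fin ℓ') K) (A : GL (Fin ℓ') K) :
    subst u A (leadingMaximalMinor h (genericMatrix K ℓ ℓ')) =
      leadingMaximalMinor h (transformedMatrix u A) := by
  change substHom u A _ = _
  unfold leadingMaximalMinor
  rw [AlgHom.map_det]
  congr 1
  ext1 a b
  simp [substHom, Matrix.mvPolynomialX]

theorem mem_orbit_iff {K : Type*} [Field K] {ℓ ℓ' : ℕ} (h : ℓ ≤ ℓ')
    (f : MvPolynomial (Fin ℓ × Fin ℓ') K) :
    f ∈ MulAction.orbit (affineGroup K ℓ ℓ') (leadingMaximalMinor h (genericMatrix K ℓ ℓ')) ↔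
      ∃ (A : GL (Fin ℓ') K) (u : Matrix (Fin ℓ) (Fin ℓ') K),
        f = leadingMaximalMinor h (transformedMatrix u A) := by
  constructor
  · rintro ⟨⟨_, u, A, rfl⟩, rfl⟩
    exact ⟨A, u, subst_leadingMaximalMinor h u A⟩
  · rintro ⟨A, u, rfl⟩
    exact ⟨⟨subst u A, u, A, rfl⟩, subst_leadingMaximalMinor h u A⟩

theorem evalAt_leadingMaximalMinor_transformedMatrix {K : Type*} [Field K] {ℓ ℓ' : ℕ}
    (h : ℓ ≤ ℓ') (u : Matrix (Fin ℓ) (Fin ℓ') K) (A : GL (Fin ℓ') K)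
    (P : Matrix (Fin ℓ) (Fin ℓ') K) :
    evalAt (leadingMaximalMinor h (transformedMatrix u A)) P =
      leadingMaximalMinor h
        (P * ((A⁻¹ : GL (Fin ℓ') K) : Matrix (Fin ℓ') (Fin ℓ') K) + u) := by
  rw [← subst_leadingMaximalMinor]
  change evalAt (substHom u A _) P = _
  rw [evalAt_substHom]
  exact evalAt_det_submatrix id (Fin.castLE h) _

theorem leadingMaximalMinor_mem_minorSpace {K : Type*} [Field K] {ℓ ℓ' : ℕ} (h : ℓ ≤ ℓ') :
    leadingMaximalMinor h (genericMatrix K ℓ ℓ') ∈ minorSpace K ℓ ℓ' :=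
  Submodule.subset_span ⟨ℓ, le_rfl, RelEmbedding.refl _, Fin.castLEOrderEmb h, rfl⟩

/-- The invertible matrices make up the proportion `invertibleDensity` of all square matrices. -/
theorem card_det_ne_zero {K : Type*} [Field K] [Fintype K] [DecidableEq K] (n : ℕ) :
    (hammingNorm (fun P : Matrix (Fin n) (Fin n) K => P.det) : ℚ) =
      invertibleDensity (Fintype.card K) n * (Fintype.card K : ℚ) ^ (n * n) := by
  have h1 : hammingNorm (fun P : Matrix (Fin n) (Fin n) K => P.det) = Nat.card (GL (Fin n) K) := by
    rw [Nat.card_eq_fintype_card]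
    symm
    refine Finset.card_bij (fun (A : GL (Fin n) K) _ => (A : Matrix (Fin n) (Fin n) K)) ?_ ?_ ?_
    · intro A _
      simpa using (Matrix.isUnit_iff_isUnit_det _).1 A.isUnit |>.ne_zero
    · intro A _ B _ h
      exact Units.ext h
    · intro P hP
      exact ⟨Matrix.GeneralLinearGroup.mkOfDetNeZero P (by simpa using hP), by simp, rfl⟩
  have hq : (0 : ℚ) < Fintype.card K := by exact_mod_cast Fintype.card_pos
  rw [h1, Matrix.card_GL_field, Fin.prod_univ_eq_prod_range
    (fun i => Fintype.card K ^ n - Fintype.card K ^ i) n, ← Finset.prod_range_reflect,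
    Nat.cast_prod, invertibleDensity, pow_mul,
    show (((Fintype.card K : ℚ) ^ n) ^ n) = ∏ _j ∈ Finset.range n, (Fintype.card K : ℚ) ^ n by simp,
    ← Finset.prod_mul_distrib]
  refine Finset.prod_congr rfl fun j hj => ?_
  have hj := Finset.mem_range.1 hj
  rw [Nat.cast_sub (Nat.pow_le_pow_right Fintype.card_pos (by omega))]
  push_cast
  rw [sub_mul, one_mul]
  congr 1
  rw [eq_inv_mul_iff_mul_eq₀ (by positivity), ← pow_add]
  congr 1
  omega

theorem hammingNorm_leadingMaximalMinor {K : Type*} [Field K] [Fintype K] [DecidableEq K]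
    {ℓ ℓ' : ℕ} (h : ℓ ≤ ℓ') :
    (hammingNorm (fun P : Matrix (Fin ℓ) (Fin ℓ') K => leadingMaximalMinor h P) : ℚ) =
      invertibleDensity (Fintype.card K) ℓ * (Fintype.card (Fin ℓ' → K) : ℚ) ^ ℓ := by
  obtain ⟨k, rfl⟩ := Nat.exists_eq_add_of_le h
  -- A matrix is split into its first `ℓ` columns and the others.
  let e : Matrix (Fin ℓ) (Fin ℓ) K × Matrix (Fin ℓ) (Fin k) K ≃ Matrix (Fin ℓ) (Fin (ℓ + k)) K :=
    { toFun := fun p i => Fin.append (p.1 i) (p.2 i)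
      invFun := fun P => (fun i j => P i (Fin.castAdd k j), fun i j => P i (Fin.natAdd ℓ j))
      left_inv := fun p => by ext <;> simp
      right_inv := fun P => by
        funext i j
        refine Fin.addCases (fun a => ?_) (fun a => ?_) j <;> simp }
  have h1 : ∀ p, leadingMaximalMinor h (e p) = p.1.det := by
    intro p
    unfold leadingMaximalMinor
    congr 1
    ext i j
    exact Fin.append_left (p.1 i) (p.2 i) j
  rw [← hammingNorm_comp_equiv e]
  simp only [h1]
  have h2 : hammingNorm (fun p : Matrix (Fin ℓ) (Fin ℓ) K × Matrix (Fin ℓ) (Fin k) K => p.1.det)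
      = hammingNorm (fun P : Matrix (Fin ℓ) (Fin ℓ) K => P.det) *
        Fintype.card (Matrix (Fin ℓ) (Fin k) K) := by
    unfold hammingNorm
    rw [← Finset.card_univ, ← Finset.card_product]
    congr 1
    ext p
    simp
  rw [h2, Nat.cast_mul, card_det_ne_zero, mul_assoc]
  congr 1
  have h3 : Fintype.card (Matrix (Fin ℓ) (Fin k) K) = (Fintype.card K ^ k) ^ ℓ := by
    have h4 : Fintype.card (Fin ℓ → Fin k → K) = (Fintype.card K ^ k) ^ ℓ := by simp
    rw [← h4]
    exact Fintype.card_congr (Equiv.refl _)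
  rw [h3, Fintype.card_fun, Fintype.card_fin]
  push_cast
  rw [← pow_mul, ← pow_mul, ← pow_add]
  congr 1
  ring

/-- Every element of the orbit has the weight of the leading maximal minor: the affine map
`P ↦ P A⁻¹ + u` permutes the matrices. -/
theorem hammingNorm_Ev_transformed {K : Type*} [Field K] [Fintype K] [DecidableEq K]
    {ℓ ℓ' : ℕ} (h : ℓ ≤ ℓ') (u : Matrix (Fin ℓ) (Fin ℓ') K) (A : GL (Fin ℓ') K) :
    (hammingNorm (Ev K ℓ ℓ' (leadingMaximalMinor h (transformedMatrix u A))) : ℚ) =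
      invertibleDensity (Fintype.card K) ℓ * (Fintype.card (Fin ℓ' → K) : ℚ) ^ ℓ := by
  rw [← hammingNorm_leadingMaximalMinor h]
  let e : Matrix (Fin ℓ) (Fin ℓ') K ≃ Matrix (Fin ℓ) (Fin ℓ') K :=
    { toFun := fun P => P * ((A⁻¹ : GL (Fin ℓ') K) : Matrix (Fin ℓ') (Fin ℓ') K) + u
      invFun := fun P => (P - u) * (A : Matrix (Fin ℓ') (Fin ℓ') K)
      left_inv := fun P => by
        dsimp only
        rw [add_sub_cancel_right, Matrix.mul_assoc, ← Units.val_mul, inv_mul_cancel,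
          Units.val_one, Matrix.mul_one]
      right_inv := fun P => by
        dsimp only
        rw [Matrix.mul_assoc, ← Units.val_mul, mul_inv_cancel, Units.val_one, Matrix.mul_one,
          sub_add_cancel] }
  rw [← hammingNorm_comp_equiv e (fun P => leadingMaximalMinor h P)]
  congr 2
  funext P
  exact evalAt_leadingMaximalMinor_transformedMatrix h u A P

/-- A linear map onto `Kˡ` is given by the first `ℓ` columns of an invertible matrix. -/
theorem exists_GL_of_surjective {K : Type*} [Field K] {ℓ ℓ' : ℕ} (h : ℓ ≤ ℓ')
    (p : (Fin ℓ' → K) →ₗ[K] (Fin ℓ → K)) (w : Fin ℓ → Fin ℓ' → K)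
    (hw : ∀ k, p (w k) = Pi.single k 1) :
    ∃ N : GL (Fin ℓ') K, ∀ x k,
      Matrix.vecMul x (N : Matrix (Fin ℓ') (Fin ℓ') K) (Fin.castLE h k) = p x k := by
  classical
  obtain ⟨m, rfl⟩ := Nat.exists_eq_add_of_le h
  let c : Fin ℓ → Fin (ℓ + m) → K := fun k j => p (Pi.single j 1) k
  have hc : ∀ x k, x ⬝ᵥ c k = p x k := by
    intro x k
    rw [show p x = p (∑ j, x j • Pi.single j 1) by
      congr 1; funext i; simp [Pi.single_apply], map_sum]
    simp [dotProduct, c]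
  have hli : LinearIndependent K c := by
    rw [Fintype.linearIndependent_iff]
    intro g hg k
    have : w k ⬝ᵥ ∑ i, g i • c i = g k := by
      rw [dotProduct_sum]
      simp only [dotProduct_smul, hc, hw]
      simp [Pi.single_apply]
    rw [← this, hg, dotProduct_zero]
  let b := Module.Basis.sumExtend hli
  have hb : ∀ k, b (Sum.inl k) = c k := by
    intro k
    simp [b, Module.Basis.sumExtend]
    rfl
  have : Fintype (Fin ℓ ⊕ Module.Basis.sumExtendIndex hli) := FiniteDimensional.fintypeBasisIndex b
  have : Fintype (Module.Basis.sumExtendIndex hli) :=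
    Fintype.ofInjective (Sum.inr : _ → Fin ℓ ⊕ _) Sum.inr_injective
  have hcard : Fintype.card (Module.Basis.sumExtendIndex hli) = m := by
    have h1 := Module.finrank_eq_nat_card_basis b
    rw [Nat.card_sum, Module.finrank_fin_fun, Nat.card_fin, Nat.card_eq_fintype_card] at h1
    omega
  let e : Fin ℓ ⊕ Module.Basis.sumExtendIndex hli ≃ Fin (ℓ + m) :=
    (Equiv.sumCongr (Equiv.refl _) (Fintype.equivFinOfCardEq hcard)).trans finSumFinEquiv
  let b' := b.reindex e
  have hb' : ∀ k, b' (Fin.castLE h k) = c k := by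
    intro k
    rw [← hb, Module.Basis.reindex_apply]
    congr 1
    rw [Equiv.symm_apply_eq]
    rfl
  have hunit : IsUnit (Matrix.of fun i j => b' j i : Matrix (Fin (ℓ + m)) (Fin (ℓ + m)) K) := by
    rw [← Matrix.linearIndependent_cols_iff_isUnit]
    exact b'.linearIndependent
  obtain ⟨N, hN⟩ := hunit
  refine ⟨N, fun x k => ?_⟩
  rw [← hc, hN, ← hb']
  rfl

/-! ### The minimum weight codewords -/

/-- A word of the code, written as a function of the rows of a matrix. The hypothesis on `φ` is
that of `exists_alternatingMap`. -/
theorem Ev_eq_map_add {K : Type*} [Field K] {ℓ ℓ' : ℕ}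
    {f : MvPolynomial (Fin ℓ × Fin ℓ') K}
    {φ : ((Fin ℓ → K) × (Fin ℓ' → K)) [⋀^Fin ℓ]→ₗ[K] K}
    (hφ : ∀ P : Matrix (Fin ℓ) (Fin ℓ') K, evalAt f P = φ (fun j => (Pi.single j 1, P j))) :
    Ev K ℓ ℓ' f = fun P : Fin ℓ → Fin ℓ' → K =>
      φ (fun j => (Pi.single j 1, 0) + LinearMap.inr K (Fin ℓ → K) (Fin ℓ' → K) (P j)) := by
  funext P
  change evalAt f P = _
  rw [hφ]
  simp

/-- The lower bound for the weights of the nonzero words of the code. -/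
theorem le_hammingNorm_Ev {K : Type*} [Field K] [Fintype K] [DecidableEq K] {ℓ ℓ' : ℕ}
    {f : MvPolynomial (Fin ℓ × Fin ℓ') K} (hf : f ∈ minorSpace K ℓ ℓ')
    (h : Ev K ℓ ℓ' f ≠ 0) :
    invertibleDensity (Fintype.card K) ℓ * (Fintype.card (Fin ℓ' → K) : ℚ) ^ ℓ ≤
      hammingNorm (Ev K ℓ ℓ' f) := by
  obtain ⟨φ, hφ⟩ := exists_alternatingMap hf
  have hE := Ev_eq_map_add hφ
  rw [← hammingNorm_comp_equiv (Matrix.of (m := Fin ℓ) (n := Fin ℓ') (α := K)), hE]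
  rw [hE] at h
  exact le_hammingNorm ℓ φ _ _ h

/-- Words whose weight does not exceed the lower bound come from the orbit of the leading maximal
minor. -/
theorem exists_transformed_of_hammingNorm_le {K : Type*} [Field K] [Fintype K] [DecidableEq K]
    {ℓ ℓ' : ℕ} (hpos : 1 ≤ ℓ) (hle : ℓ ≤ ℓ')
    {f : MvPolynomial (Fin ℓ × Fin ℓ') K} (hf : f ∈ minorSpace K ℓ ℓ')
    (h : Ev K ℓ ℓ' f ≠ 0)
    (hw : (hammingNorm (Ev K ℓ ℓ' f) : ℚ) ≤
      invertibleDensity (Fintype.card K) ℓ * (Fintype.card (Fin ℓ' → K) : ℚ) ^ ℓ) :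
    ∃ (A : GL (Fin ℓ') K) (u : Matrix (Fin ℓ) (Fin ℓ') K),
      f = leadingMaximalMinor hle (transformedMatrix u A) := by
  obtain ⟨φ, hφ⟩ := exists_alternatingMap hf
  have hE := Ev_eq_map_add hφ
  rw [← hammingNorm_comp_equiv (Matrix.of (m := Fin ℓ) (n := Fin ℓ') (α := K)), hE] at hw
  rw [hE] at h
  obtain ⟨n, rfl⟩ := Nat.exists_eq_add_of_le' hpos
  obtain ⟨z, p, w, hpw, hdet⟩ := exists_eq_det_of_hammingNorm_le φ _ _ h hw
  obtain ⟨N, hN⟩ := exists_GL_of_surjective hle p w hpw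
  refine ⟨N⁻¹, -(Matrix.of z * (N : Matrix (Fin ℓ') (Fin ℓ') K)), ?_⟩
  refine eq_of_evalAt_eq (degreeOf_le_one_of_mem_minorSpace hf)
    (degreeOf_det_submatrix_le _ (degreeOf_transformedMatrix_le _ _)
      Function.injective_id _) fun P => ?_
  rw [evalAt_leadingMaximalMinor_transformedMatrix, inv_inv]
  refine (congrFun hE P).trans ((hdet P).trans ?_)
  unfold leadingMaximalMinor
  congr 1
  ext i k
  rw [← sub_eq_add_neg, Matrix.submatrix_apply, Matrix.sub_apply, Matrix.mul_apply_eq_vecMul,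
    Matrix.mul_apply_eq_vecMul, id, hN, hN]
  rfl

theorem Ev_transformed_ne_zero {K : Type*} [Field K] [Fintype K] [DecidableEq K] {ℓ ℓ' : ℕ}
    (hle : ℓ ≤ ℓ') (u : Matrix (Fin ℓ) (Fin ℓ') K) (A : GL (Fin ℓ') K) :
    Ev K ℓ ℓ' (leadingMaximalMinor hle (transformedMatrix u A)) ≠ 0 := by
  have hW : (0 : ℚ) < Fintype.card (Fin ℓ' → K) := by exact_mod_cast Fintype.card_pos
  have h := mul_pos (invertibleDensity_pos (Fintype.one_lt_card (α := K)) ℓ) (pow_pos hW ℓ)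
  rw [← hammingNorm_Ev_transformed hle u A] at h
  exact hammingNorm_pos_iff.1 (by exact_mod_cast h)

/-- The minimum distance is the weight of the leading maximal minor. -/
theorem minDist_code {K : Type*} [Field K] [Fintype K] [DecidableEq K] {ℓ ℓ' : ℕ}
    (hle : ℓ ≤ ℓ') : (minDist (code K ℓ ℓ') : ℚ) =
      invertibleDensity (Fintype.card K) ℓ * (Fintype.card (Fin ℓ' → K) : ℚ) ^ ℓ := by
  have hne := Ev_transformed_ne_zero (K := K) hle 0 1
  have hN := hammingNorm_Ev_transformed (K := K) hle 0 1
  have hmem : Ev K ℓ ℓ' (leadingMaximalMinor hle (transformedMatrix 0 1)) ∈ code K ℓ ℓ' := by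
    refine Submodule.mem_map_of_mem ?_
    rw [← subst_leadingMaximalMinor]
    change substHom 0 1 _ ∈ _
    rw [substHom_one]
    exact leadingMaximalMinor_mem_minorSpace hle
  have hmin : hammingNorm (Ev K ℓ ℓ' (leadingMaximalMinor hle (transformedMatrix 0 1))) ∈
      {d | ∃ x ∈ code K ℓ ℓ', ∃ y ∈ code K ℓ ℓ', x ≠ y ∧ d = hammingDist x y} :=
    ⟨_, hmem, 0, Submodule.zero_mem _, hne, (hammingDist_zero_right _).symm⟩
  refine le_antisymm ?_ ?_
  · rw [← hN]
    exact_mod_cast Nat.sInf_le hmin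
  · obtain ⟨x, hx, y, hy, hxy, hd⟩ := Nat.sInf_mem ⟨_, hmin⟩
    rw [minDist, hd, hammingDist_eq_hammingNorm, neg_add_eq_sub]
    obtain ⟨g, hg, hgx⟩ := Submodule.sub_mem _ hy hx
    have hxy' := sub_ne_zero.2 hxy.symm
    rw [← hgx] at hxy' ⊢
    exact le_hammingNorm_Ev hg hxy'

end AffineGrassmann

theorem mainTheorem2 {K : Type*} [Field K] [Fintype K] [DecidableEq K]
    {ℓ ℓ' : ℕ} (hpos : 1 ≤ ℓ) (hle : ℓ ≤ ℓ')
    (f : MvPolynomial (Fin ℓ × Fin ℓ') K) (hf : f ∈ AffineGrassmann.minorSpace K ℓ ℓ') :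
    (AffineGrassmann.IsMinWeightCodeword (AffineGrassmann.code K ℓ ℓ')
        (AffineGrassmann.Ev K ℓ ℓ' f) ↔
      f ∈ MulAction.orbit (AffineGrassmann.affineGroup K ℓ ℓ')
        (AffineGrassmann.leadingMaximalMinor hle (AffineGrassmann.genericMatrix K ℓ ℓ'))) ∧
    (hammingNorm (AffineGrassmann.Ev K ℓ ℓ' f) =
        AffineGrassmann.minDist (AffineGrassmann.code K ℓ ℓ') ↔
      ∃ (A : GL (Fin ℓ') K) (u : Matrix (Fin ℓ) (Fin ℓ') K),
        f = AffineGrassmann.leadingMaximalMinor hle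
          (AffineGrassmann.transformedMatrix u A)) := by
  open AffineGrassmann in
  have hD := minDist_code (K := K) hle
  have hsecond : hammingNorm (Ev K ℓ ℓ' f) = minDist (code K ℓ ℓ') ↔
      ∃ (A : GL (Fin ℓ') K) (u : Matrix (Fin ℓ) (Fin ℓ') K),
        f = leadingMaximalMinor hle (transformedMatrix u A) := by
    constructor
    · intro h
      refine exists_transformed_of_hammingNorm_le hpos hle hf ?_ ?_
      · -- The minimum distance is positive, being the weight of a nonzero word.
        rw [← hammingNorm_pos_iff, h]
        have := hammingNorm_pos_iff.2 (Ev_transformed_ne_zero (K := K) hle 0 1)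
        have h2 := hammingNorm_Ev_transformed (K := K) hle 0 1
        rw [← hD] at h2
        exact (by exact_mod_cast h2 : hammingNorm _ = minDist _) ▸ this
      · rw [h, hD]
    · rintro ⟨A, u, rfl⟩
      have := hammingNorm_Ev_transformed hle u A
      rw [← hD] at this
      exact_mod_cast this
  refine ⟨?_, hsecond⟩
  rw [mem_orbit_iff, ← hsecond]
  constructor
  · rintro ⟨-, hne, hmin⟩
    refine le_antisymm ?_ ?_
    · have hmem := leadingMaximalMinor_mem_minorSpace (K := K) hle
      have h1 := (mem_orbit_iff hle _).1 (MulAction.mem_orbit_self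
        (M := affineGroup K ℓ ℓ') (leadingMaximalMinor hle (genericMatrix K ℓ ℓ')))
      obtain ⟨A, u, h1⟩ := h1
      have h2 := hammingNorm_Ev_transformed hle u A
      have h3 := Ev_transformed_ne_zero hle u A
      rw [← hD, ← h1] at h2
      rw [← h1] at h3
      have h4 := hmin _ (Submodule.mem_map_of_mem hmem) h3
      exact h4.trans (by exact_mod_cast h2.le)
    · have := le_hammingNorm_Ev hf hne
      rw [← hD] at this
      exact_mod_cast this
  · intro h
    refine ⟨Submodule.mem_map_of_mem hf, ?_, ?_⟩
    · obtain ⟨A, u, rfl⟩ := hsecond.1 h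
      exact Ev_transformed_ne_zero hle u A
    · rintro _ ⟨g, hg, rfl⟩ hne
      have := le_hammingNorm_Ev hg hne
      rw [← hD, ← h] at this
      exact_mod_cast this
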